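/- Let $Z\sim P$ be a data point with values in a measurable space, let $X$ be a measurable function of $Z$ (the covariates), and for each $g$ in a nuisance space $G$ let $\hat Y(g)$ be a real-valued label, a function of $Z$ (jointly measurable in $(g,Z)$). Let $g_0\in G$ be the true nuisance with $\mathbb E[\hat Y(g_0)^2]<\infty$, and put $\tau_0(X)=\mathbb E[\hat Y(g_0)\mid X]$ and $\mathrm{Bias}(X;g)=\mathbb E[\hat Y(g)-\hat Y(g_0)\mid X]$. Let $f_1,\dots,f_M$ be candidate functions of $X$, $\Theta=\{\theta\in\mathbb R_{\ge0}^M:\sum_j\theta_j=1\}$, $f_\theta=\sum_j\theta_jf_j$, $\|h\|^2=\mathbb E[h(X)^2]$, and let $\pi_1,\dots,\pi_M>0$ with $\sum_j\pi_j=1$ be prior weights. Let $Z_1,\dots,Z_n$ ($n\ge1$) be i.i.d. copies of $Z$ with covariates $X_i$, let $\hat g$ be a random element of $G$ independent of $(Z_1,\dots,Z_n)$ (trained on a separate sample), and write $\hat Y_i(\hat g)$ for the label of $Z_i$. In $\mathrm{Bias}(X;\hat g)$ and $\mathbb E|\mathrm{Bias}(X;\hat g)|$ below, the expectations are over an independent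 data point $Z$, with $\hat g$ held fixed. Assume that almost surely $|\hat Y(\hat g)|\le U$ and $|f_j(X)|\le U$ for all $j$, and that for some constants $C\ge 0$ and $0<\gamma\le1$ $$\|f_\theta(X)-f_{\theta'}(X)\|_{L^\infty}\le C\,\|f_\theta(X)-f_{\theta'}(X)\|_{L^2}^{\gamma}\qquad\text{for all }\theta,\theta'\in\Theta .$$ Let $\mathrm{Error}(\hat g)=2C\,\mathbb E\left[|\mathrm{Bias}(X;\hat g)|\right]$, let $\beta\ge\max\{112\,U^2,56\,U^3\}$, and let $\hat\theta$ be a Q-aggregation ensemble with $\nu=1/2$, that is, a minimizer over $\theta\in\Theta$ of $$\frac1n\sum_{i=1}^n\Big[\tfrac12\big(\hat Y_i(\hat g)-f_\theta(X_i)\big)^2+\tfrac12\sum_{j=1}^M\theta_j\big(\hat Y_i(\hat g)-f_j(X_i)\big)^2\Big]+\frac{\beta}{n}\sum_{j=1}^M\theta_j\log\frac1{\pi_j}.$$ Then there is an absolute constant $K$ (depending on none of the above data) such that for every $\delta\in(0,1)$, with probability at least $1-\delta$, $$\|f_{\hat\theta}-\tau_0\|^2\le\min_{1\le j\le M}\Big(\|f_j-\tau_0\|^2+\frac{\beta}{n}\log\frac1{\pi_j}\Big)+K\Big(\max\{U^2,U^3\}\,\frac{\log(1/\delta)}{n}+\mathrm{Error}(\hat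 g)^{\frac{2}{2-\gamma}}\Big).$$ -/

import Mathlib

open MeasureTheory ProbabilityTheory
open scoped ENNReal NNReal

noncomputable section

namespace QAgg

/-- The ensemble `f_θ = ∑ j, θ_j f_j`. -/
def ensemble {𝒳 : Type*} {M : ℕ} (f : Fin M → 𝒳 → ℝ) (θ : Fin M → ℝ) (x : 𝒳) : ℝ :=
  ∑ j, θ j * f j x

/-- The square loss `(Y - h(X))²` at the data point `z`; the label `Y` and the covariates `X`
are functions of the full data point. -/
def sqLoss {𝒵 𝒳 : Type*} (Y : 𝒵 → ℝ) (X : 𝒵 → 𝒳) (h : 𝒳 → ℝ) (z : 𝒵) : ℝ :=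
  (Y z - h (X z)) ^ 2

/-- The modified loss `(1 - ν) ℓ_θ + ν ∑ j, θ_j ℓ_{e_j}`. -/
def modLoss {𝒵 𝒳 : Type*} {M : ℕ} (ν : ℝ) (Y : 𝒵 → ℝ) (X : 𝒵 → 𝒳) (f : Fin M → 𝒳 → ℝ)
    (θ : Fin M → ℝ) (z : 𝒵) : ℝ :=
  (1 - ν) * sqLoss Y X (ensemble f θ) z + ν * ∑ j, θ j * sqLoss Y X (f j) z

/-- The Q-aggregation objective: empirical modified loss plus `(β / n) ∑ j, θ_j log (1 / w_j)`,
where `w` are the prior weights and `s` is the sample. -/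
def objective {𝒵 𝒳 : Type*} {M n : ℕ} (ν β : ℝ) (w : Fin M → ℝ) (Y : 𝒵 → ℝ) (X : 𝒵 → 𝒳)
    (f : Fin M → 𝒳 → ℝ) (s : Fin n → 𝒵) (θ : Fin M → ℝ) : ℝ :=
  (1 / (n : ℝ)) * ∑ i, modLoss ν Y X f θ (s i) + β / n * ∑ j, θ j * Real.log (1 / w j)

/-- `θ` is a Q-aggregation weight vector: a minimizer of the objective over the simplex. -/
def IsQAggregate {𝒵 𝒳 : Type*} {M n : ℕ} (ν β : ℝ) (w : Fin M → ℝ) (Y : 𝒵 → ℝ) (X : 𝒵 → 𝒳)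
    (f : Fin M → 𝒳 → ℝ) (s : Fin n → 𝒵) (θ : Fin M → ℝ) : Prop :=
  θ ∈ stdSimplex ℝ (Fin M) ∧
    ∀ θ' ∈ stdSimplex ℝ (Fin M), objective ν β w Y X f s θ ≤ objective ν β w Y X f s θ'

/-- Conditional expectation `E[W | X]` under the law `P` of the data point, as a function of the
data point. -/
def condX {𝒵 𝒳 : Type*} [MeasurableSpace 𝒵] [m𝒳 : MeasurableSpace 𝒳] (P : Measure 𝒵) (X : 𝒵 → 𝒳)
    (W : 𝒵 → ℝ) : 𝒵 → ℝ :=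
  P[W | m𝒳.comap X]

/-- `Bias(X; g) = E[Ŷ(g) - Ŷ(g₀) | X]`. -/
def bias {G 𝒵 𝒳 : Type*} [MeasurableSpace 𝒵] [MeasurableSpace 𝒳] (P : Measure 𝒵) (X : 𝒵 → 𝒳)
    (Yhat : G → 𝒵 → ℝ) (g₀ g : G) : 𝒵 → ℝ :=
  condX P X (fun z => Yhat g z - Yhat g₀ z)

/-- `Error(g) = 2 C E|Bias(X; g)|`. -/
def nuisanceError {G 𝒵 𝒳 : Type*} [MeasurableSpace 𝒵] [MeasurableSpace 𝒳] (P : Measure 𝒵)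
    (X : 𝒵 → 𝒳) (Yhat : G → 𝒵 → ℝ) (g₀ : G) (C : ℝ≥0) (g : G) : ℝ :=
  2 * (C : ℝ) * ∫ z, |bias P X Yhat g₀ g z| ∂P

/-- `‖h - τ₀‖² = E[(h(X) - τ₀(X))²]`, where `τ₀(X) = E[Ŷ(g₀) | X]`. -/
def sqDist {G 𝒵 𝒳 : Type*} [MeasurableSpace 𝒵] [MeasurableSpace 𝒳] (P : Measure 𝒵)
    (X : 𝒵 → 𝒳) (Yhat : G → 𝒵 → ℝ) (g₀ : G) (h : 𝒳 → ℝ) : ℝ :=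
  ∫ z, (h (X z) - condX P X (Yhat g₀) z) ^ 2 ∂P

end QAgg

end

/-! The modified loss makes the objective quadratic along segments of the simplex, so first-order
optimality at `θ` towards a vertex `k` controls the empirical excess loss plus half of the spread `∑
θ_j (f_j - f_k)²` (`IsQAggregate.sum_pairExcess_le`). This quantity is the `θ_j θ_l`-average of the
finitely many functions `pairExcess`. Hence a data-dependent `θ` needs no empirical process theory:
a Bernstein bound for each pair `(j, l)` and a union bound with weights `w_j w_l` suffice
(`measure_exists_pairDeviation_le`).

With `S_j = ‖f_j - f_k‖²`, the variance term costs `2/7 ∑ θ_j S_j` out of the available `1/2 ∑ θ_j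
S_j`. By Jensen, the remaining `3/14` dominates `3/14 ‖f_θ - f_k‖²`, a negative curvature term. The
logarithms from the union bound are absorbed by the penalty because `β ≥ 112 U²`
(`IsQAggregate.integral_excess_le`).

Passing from `Ŷ(ĝ)` to `τ₀` costs `2 E[(f_θ - f_k) Bias]` (`sqDist_sub_sqDist`). By Hölder and the
norm comparison this is at most `Error · ‖f_θ - f_k‖^γ`, which a Young-type inequality splits into
the curvature term and a multiple of `Error^(2/(2-γ))`. -/

namespace QAgg

/-! ### Exponential moments and the Chernoff bound -/

section Probability

/-- One-sided Bernstein-type exponential moment bound for a bounded function. -/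
lemma lintegral_exp_deviation_le_one {𝒵 : Type*} [MeasurableSpace 𝒵] {P : Measure 𝒵}
    [IsProbabilityMeasure P] {T : 𝒵 → ℝ} (hT : Measurable T) {B lam v : ℝ}
    (hB : ∀ᵐ z ∂P, |T z| ≤ B) (hlam : 0 ≤ lam) (hlamB : lam * B ≤ 1)
    (hv : ∫ z, T z ^ 2 ∂P ≤ v) :
    ∫⁻ z, ENNReal.ofReal (Real.exp (lam * (∫ z', T z' ∂P - T z) - lam ^ 2 * v)) ∂P ≤ 1 := by
  have hTi : Integrable T P :=
    Integrable.of_bound hT.aestronglyMeasurable B (by simpa using hB)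
  have hT2 : Integrable (fun z => T z ^ 2) P := by
    refine Integrable.of_bound (hT.pow_const 2).aestronglyMeasurable (B ^ 2) ?_
    filter_upwards [hB] with z hz
    rw [Real.norm_eq_abs, abs_pow]
    gcongr
  set c : ℝ := Real.exp (lam * ∫ z', T z' ∂P - lam ^ 2 * v) with hc
  have hle : ∀ᵐ z ∂P, Real.exp (lam * (∫ z', T z' ∂P - T z) - lam ^ 2 * v)
      ≤ c * (1 - lam * T z + lam ^ 2 * T z ^ 2) := by
    filter_upwards [hB] with z hz
    have h1 : |-(lam * T z)| ≤ 1 := by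
      rw [abs_neg, abs_mul, abs_of_nonneg hlam]
      exact (mul_le_mul_of_nonneg_left hz hlam).trans hlamB
    -- This gives `exp x ≤ 1 + x + x²` for `|x| ≤ 1`, at `x = -λT`.
    have h2 := (abs_le.1 (Real.abs_exp_sub_one_sub_id_le h1)).2
    have h3 : lam * (∫ z', T z' ∂P - T z) - lam ^ 2 * v
        = (lam * ∫ z', T z' ∂P - lam ^ 2 * v) + -(lam * T z) := by ring
    rw [h3, Real.exp_add]
    refine mul_le_mul_of_nonneg_left ?_ (Real.exp_pos _).le
    nlinarith
  have hint : Integrable (fun z => c * (1 - lam * T z + lam ^ 2 * T z ^ 2)) P :=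
    (((integrable_const 1).sub (hTi.const_mul lam)).add (hT2.const_mul _)).const_mul c
  calc ∫⁻ z, ENNReal.ofReal (Real.exp (lam * (∫ z', T z' ∂P - T z) - lam ^ 2 * v)) ∂P
      ≤ ∫⁻ z, ENNReal.ofReal (c * (1 - lam * T z + lam ^ 2 * T z ^ 2)) ∂P :=
        lintegral_mono_ae (hle.mono fun z hz => ENNReal.ofReal_le_ofReal hz)
    _ = ENNReal.ofReal (∫ z, c * (1 - lam * T z + lam ^ 2 * T z ^ 2) ∂P) :=
        (ofReal_integral_eq_lintegral_ofReal hint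
          (hle.mono fun z hz => (Real.exp_pos _).le.trans hz)).symm
    _ ≤ 1 := by
        rw [ENNReal.ofReal_le_one, integral_const_mul,
          integral_add (f := fun z => 1 - lam * T z) ((integrable_const 1).sub (hTi.const_mul lam))
            (hT2.const_mul _),
          integral_sub (integrable_const 1) (hTi.const_mul lam), integral_const_mul,
          integral_const_mul]
        simp only [integral_const, probReal_univ, smul_eq_mul, mul_one]
        -- `1 + y ≤ exp y` bounds the averaged quadratic by exactly `1 / c`.
        have h4 : 1 - lam * ∫ z, T z ∂P + lam ^ 2 * ∫ z, T z ^ 2 ∂P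
            ≤ Real.exp (-(lam * ∫ z, T z ∂P - lam ^ 2 * v)) := by
          have h5 := Real.add_one_le_exp (-(lam * ∫ z, T z ∂P - lam ^ 2 * v))
          nlinarith [mul_le_mul_of_nonneg_left hv (sq_nonneg lam)]
        calc c * (1 - lam * ∫ z, T z ∂P + lam ^ 2 * ∫ z, T z ^ 2 ∂P)
            ≤ c * Real.exp (-(lam * ∫ z, T z ∂P - lam ^ 2 * v)) :=
              mul_le_mul_of_nonneg_left h4 (Real.exp_pos _).le
          _ = 1 := by rw [hc, ← Real.exp_add, add_neg_cancel, Real.exp_zero]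

/-- A Chernoff bound for sums over an i.i.d. sample of a function that also depends on an
independent random element. -/
lemma measure_log_le_sum_le {𝒵 G Ω : Type*} [MeasurableSpace 𝒵] [MeasurableSpace G]
    [MeasurableSpace Ω] {P : Measure 𝒵} {μ : Measure Ω} [IsProbabilityMeasure μ]
    {n : ℕ} {Z : Fin n → Ω → 𝒵} (hZ : ∀ i, Measurable (Z i))
    (hlaw : ∀ i, μ.map (Z i) = P) (hZind : iIndepFun Z μ)
    {ghat : Ω → G} (hg : Measurable ghat) (hind : IndepFun ghat (fun ω i => Z i ω) μ)
    {φ : G → 𝒵 → ℝ} (hφ : Measurable (Function.uncurry φ))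
    (hexp : ∀ᵐ g ∂(μ.map ghat), ∫⁻ z, ENNReal.ofReal (Real.exp (φ g z)) ∂P ≤ 1)
    {η : ℝ} (hη : 0 < η) :
    μ {ω | Real.log (1 / η) ≤ ∑ i, φ (ghat ω) (Z i ω)} ≤ ENNReal.ofReal η := by
  have hZm : Measurable (fun ω i => Z i ω) := measurable_pi_iff.2 hZ
  set F : G × (Fin n → 𝒵) → ℝ≥0∞ := fun p => ∏ i, ENNReal.ofReal (Real.exp (φ p.1 (p.2 i)))
    with hF
  have hFm : Measurable F := by
    refine Finset.measurable_prod _ fun i _ => ?_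
    exact (Real.measurable_exp.comp
      (hφ.comp (measurable_fst.prodMk ((measurable_pi_apply i).comp measurable_snd)))).ennreal_ofReal
  have hpair : Measurable (fun ω => (ghat ω, fun i => Z i ω)) := hg.prodMk hZm
  have hint : ∫⁻ ω, F (ghat ω, fun i => Z i ω) ∂μ ≤ 1 := by
    have : IsProbabilityMeasure (μ.map ghat) := Measure.isProbabilityMeasure_map hg.aemeasurable
    have : IsProbabilityMeasure (μ.map fun ω i => Z i ω) :=
      Measure.isProbabilityMeasure_map hZm.aemeasurable
    -- Independence makes the joint law a product, so `g` can be frozen and the sample integrated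
    -- first.
    rw [← lintegral_map hFm hpair, hind.map_prod_eq_prod_map_map hg.aemeasurable hZm.aemeasurable,
      lintegral_prod _ hFm.aemeasurable]
    calc ∫⁻ g, ∫⁻ s, F (g, s) ∂(μ.map fun ω i => Z i ω) ∂(μ.map ghat)
        ≤ ∫⁻ _, 1 ∂(μ.map ghat) := by
          refine lintegral_mono_ae (hexp.mono fun g hgi => ?_)
          have hψ : Measurable fun z => ENNReal.ofReal (Real.exp (φ g z)) :=
            (Real.measurable_exp.comp (hφ.comp measurable_prodMk_left)).ennreal_ofReal
          rw [lintegral_map (f := fun s => F (g, s)) (hFm.comp measurable_prodMk_left) hZm]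
          have := lintegral_prod_eq_prod_lintegral_of_indepFun Finset.univ
            (fun i ω => ENNReal.ofReal (Real.exp (φ g (Z i ω))))
            (hZind.comp (fun _ z => ENNReal.ofReal (Real.exp (φ g z))) fun _ => hψ)
            fun i => hψ.comp (hZ i)
          rw [hF, this]
          refine Finset.prod_le_one' fun i _ => ?_
          rw [← lintegral_map hψ (hZ i), hlaw i]
          exact hgi
      _ = 1 := by simp
  calc μ {ω | Real.log (1 / η) ≤ ∑ i, φ (ghat ω) (Z i ω)}
      ≤ μ {ω | ENNReal.ofReal (1 / η) ≤ F (ghat ω, fun i => Z i ω)} := by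
        refine measure_mono fun ω hω => ?_
        simp only [Set.mem_ofPred_eq, hF] at hω ⊢
        rw [← ENNReal.ofReal_prod_of_nonneg fun i _ => (Real.exp_pos _).le, ← Real.exp_sum]
        exact ENNReal.ofReal_le_ofReal ((Real.log_le_iff_le_exp (by positivity)).1 hω)
    _ ≤ (∫⁻ ω, F (ghat ω, fun i => Z i ω) ∂μ) / ENNReal.ofReal (1 / η) :=
        meas_ge_le_lintegral_div (hFm.comp hpair).aemeasurable (by simpa using hη)
          ENNReal.ofReal_ne_top
    _ ≤ 1 / ENNReal.ofReal (1 / η) := by gcongr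
    _ = ENNReal.ofReal η := by
        rw [one_div, one_div, ENNReal.ofReal_inv_of_pos hη, inv_inv]

end Probability

/-! ### First-order optimality and the pairwise excess loss -/

section Optimality

variable {𝒵 𝒳 : Type*} {M : ℕ}

/-- The pairwise excess loss `(f_j - f_k) (f_j / 2 + f_k / 2 + f_l - 2 Y)`. -/
noncomputable def pairExcess (Y : 𝒵 → ℝ) (X : 𝒵 → 𝒳) (f : Fin M → 𝒳 → ℝ) (k j l : Fin M)
    (z : 𝒵) : ℝ :=
  (f j (X z) - f k (X z)) * (f j (X z) / 2 + f k (X z) / 2 + f l (X z) - 2 * Y z)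

lemma ensemble_single (f : Fin M → 𝒳 → ℝ) (k : Fin M) (x : 𝒳) :
    ensemble f (Pi.single k 1) x = f k x := by
  simp [ensemble, Pi.single_apply]

lemma ensemble_sub_eq {θ : Fin M → ℝ} (hθ : ∑ j, θ j = 1) (f : Fin M → 𝒳 → ℝ) (k : Fin M)
    (x : 𝒳) : ensemble f θ x - f k x = ∑ j, θ j * (f j x - f k x) := by
  simp only [ensemble, mul_sub, Finset.sum_sub_distrib, ← Finset.sum_mul, hθ, one_mul]

/-- The first term on the right is the excess square loss of `f_θ` over `f_k`; the second is the
spread that supplies curvature. Writing both as one average over pairs reduces uniformity in `θ` to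
finitely many functions. -/
lemma sum_pairExcess {θ : Fin M → ℝ} (hθ : ∑ j, θ j = 1) (Y : 𝒵 → ℝ) (X : 𝒵 → 𝒳)
    (f : Fin M → 𝒳 → ℝ) (k : Fin M) (z : 𝒵) :
    ∑ j, ∑ l, θ j * θ l * pairExcess Y X f k j l z
      = (ensemble f θ (X z) - f k (X z)) * (ensemble f θ (X z) + f k (X z) - 2 * Y z)
        + 1 / 2 * ∑ j, θ j * (f j (X z) - f k (X z)) ^ 2 := by
  set x := X z
  have h1 : ∀ j, ∑ l, θ j * θ l * pairExcess Y X f k j l z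
      = 1 / 2 * (θ j * (f j x - f k x) ^ 2)
        + (θ j * (f j x - f k x)) * (f k x + ensemble f θ x - 2 * Y z) := by
    intro j
    have h2 : ∀ l, θ j * θ l * pairExcess Y X f k j l z
        = θ l * (θ j * (f j x - f k x) * (f j x / 2 + f k x / 2 - 2 * Y z))
          + θ j * (f j x - f k x) * (θ l * f l x) := by
      intro l; simp only [pairExcess, x]; ring
    simp only [h2, Finset.sum_add_distrib, ← Finset.sum_mul, ← Finset.mul_sum, hθ]
    rw [show ∑ l, θ l * f l x = ensemble f θ x from rfl]
    ring
  simp only [h1, Finset.sum_add_distrib, ← Finset.sum_mul, ← Finset.mul_sum]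
  rw [← ensemble_sub_eq hθ]
  ring

/-- The expansion in `t` is exact; its linear coefficient is all that optimality uses. -/
lemma modLoss_lineMap {θ : Fin M → ℝ} (hθ : ∑ j, θ j = 1) (Y : 𝒵 → ℝ) (X : 𝒵 → 𝒳)
    (f : Fin M → 𝒳 → ℝ) (k : Fin M) (t : ℝ) (z : 𝒵) :
    modLoss (1 / 2) Y X f (AffineMap.lineMap θ (Pi.single k 1) t) z
      = modLoss (1 / 2) Y X f θ z
        - t * ∑ j, ∑ l, θ j * θ l * pairExcess Y X f k j l z
        + t ^ 2 * (1 / 2 * (ensemble f θ (X z) - f k (X z)) ^ 2) := by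
  have hpt : ∀ j, (AffineMap.lineMap θ (Pi.single k (1 : ℝ)) t : Fin M → ℝ) j
      = (1 - t) * θ j + t * (Pi.single k (1 : ℝ) : Fin M → ℝ) j := by
    intro j
    simp [AffineMap.lineMap_apply]; ring
  have hlin : ∀ a : Fin M → ℝ,
      ∑ j, (AffineMap.lineMap θ (Pi.single k (1 : ℝ)) t : Fin M → ℝ) j * a j
        = (1 - t) * ∑ j, θ j * a j + t * a k := by
    intro a
    simp only [hpt, add_mul, Finset.sum_add_distrib, mul_assoc, ← Finset.mul_sum]
    simp [Pi.single_apply]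
  have hens : ensemble f (AffineMap.lineMap θ (Pi.single k 1) t) (X z)
      = (1 - t) * ensemble f θ (X z) + t * f k (X z) := hlin fun j => f j (X z)
  have hsq : ∑ j, θ j * sqLoss Y X (f j) z
      = sqLoss Y X (f k) z + ∑ j, θ j * (f j (X z) - f k (X z)) ^ 2
        + 2 * (f k (X z) - Y z) * (ensemble f θ (X z) - f k (X z)) := by
    rw [ensemble_sub_eq hθ]
    have h1 : ∀ j, θ j * sqLoss Y X (f j) z = θ j * sqLoss Y X (f k) z
        + θ j * (f j (X z) - f k (X z)) ^ 2
        + 2 * (f k (X z) - Y z) * (θ j * (f j (X z) - f k (X z))) := by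
      intro j; simp only [sqLoss]; ring
    simp only [h1, Finset.sum_add_distrib, ← Finset.sum_mul, ← Finset.mul_sum, hθ, one_mul]
  rw [sum_pairExcess hθ, modLoss, modLoss, hlin fun j => sqLoss Y X (f j) z, hsq]
  simp only [sqLoss, hens]
  ring

lemma nonneg_of_forall_mul_add_sq_nonneg {a b : ℝ} (h : ∀ t : ℝ, 0 < t → t ≤ 1 → 0 ≤ t * a + t ^ 2 * b) :
    0 ≤ a := by
  by_contra! ha
  have hb : 0 < |b| + 1 := by positivity
  -- This choice forces `t * b ≤ -a / 2`, hence `a + t * b < 0`.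
  set t := min 1 (-a / (2 * (|b| + 1))) with ht
  have htpos : 0 < t := lt_min one_pos (by apply div_pos <;> linarith)
  have h1 := h t htpos (min_le_left _ _)
  have h2 : t * (2 * (|b| + 1)) ≤ -a :=
    (le_div_iff₀ (by positivity)).1 (min_le_right _ _)
  have h3 : t * b ≤ t * (|b| + 1) := by
    apply mul_le_mul_of_nonneg_left _ htpos.le
    linarith [le_abs_self b]
  have h4 : t * (a + t * b) < 0 := mul_neg_of_pos_of_neg htpos (by nlinarith)
  nlinarith

/-- First-order optimality of the Q-aggregation weights in the direction of a vertex. -/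
lemma IsQAggregate.sum_pairExcess_le {n : ℕ} {β : ℝ} {w : Fin M → ℝ} {Y : 𝒵 → ℝ} {X : 𝒵 → 𝒳}
    {f : Fin M → 𝒳 → ℝ} {s : Fin n → 𝒵} {θ : Fin M → ℝ}
    (h : IsQAggregate (1 / 2) β w Y X f s θ) (k : Fin M) :
    1 / (n : ℝ) * ∑ i, ∑ j, ∑ l, θ j * θ l * pairExcess Y X f k j l (s i)
      ≤ β / n * Real.log (1 / w k) - β / n * ∑ j, θ j * Real.log (1 / w j) := by
  have hθ : ∑ j, θ j = 1 := h.1.2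
  rw [← sub_nonneg]
  refine nonneg_of_forall_mul_add_sq_nonneg
    (b := 1 / (n : ℝ) * ∑ i, 1 / 2 * (ensemble f θ (X (s i)) - f k (X (s i))) ^ 2)
    fun t ht0 ht1 => ?_
  have hmem : (AffineMap.lineMap θ (Pi.single k (1 : ℝ)) t : Fin M → ℝ) ∈ stdSimplex ℝ (Fin M) :=
    (convex_stdSimplex ℝ (Fin M)).lineMap_mem h.1 (single_mem_stdSimplex ℝ k) ⟨ht0.le, ht1⟩
  have h1 := h.2 _ hmem
  have hpen : ∑ j, (AffineMap.lineMap θ (Pi.single k (1 : ℝ)) t : Fin M → ℝ) j * Real.log (1 / w j)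
      = (1 - t) * ∑ j, θ j * Real.log (1 / w j) + t * Real.log (1 / w k) := by
    have hpt : ∀ j, (AffineMap.lineMap θ (Pi.single k (1 : ℝ)) t : Fin M → ℝ) j
        = (1 - t) * θ j + t * (Pi.single k (1 : ℝ) : Fin M → ℝ) j := by
      intro j
      simp [AffineMap.lineMap_apply]; ring
    simp only [hpt, add_mul, Finset.sum_add_distrib, mul_assoc, ← Finset.mul_sum]
    simp [Pi.single_apply]
  simp only [objective, modLoss_lineMap hθ, hpen, Finset.sum_add_distrib, Finset.sum_sub_distrib]
    at h1
  simp only [← Finset.mul_sum] at h1 ⊢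
  linarith

end Optimality

end QAgg
namespace QAgg

/-! ### Uniform deviations and the oracle inequality for the square loss -/

section Deviation

lemma abs_pairExcess_le {𝒵 𝒳 : Type*} {M : ℕ} {Y : 𝒵 → ℝ} {X : 𝒵 → 𝒳}
    {f : Fin M → 𝒳 → ℝ} {U : ℝ} {z : 𝒵}
    (hf : ∀ j, |f j (X z)| ≤ U) (hY : |Y z| ≤ U) (k j l : Fin M) :
    |pairExcess Y X f k j l z| ≤ 4 * U * |f j (X z) - f k (X z)| := by
  rw [pairExcess, abs_mul, mul_comm]
  refine mul_le_mul_of_nonneg_right ?_ (abs_nonneg _)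
  have h1 := abs_le.1 (hf j)
  have h2 := abs_le.1 (hf k)
  have h3 := abs_le.1 (hf l)
  have h4 := abs_le.1 hY
  rw [abs_le]
  constructor <;> linarith

lemma abs_pairExcess_le_sq {𝒵 𝒳 : Type*} {M : ℕ} {Y : 𝒵 → ℝ} {X : 𝒵 → 𝒳}
    {f : Fin M → 𝒳 → ℝ} {U : ℝ} {z : 𝒵}
    (hf : ∀ j, |f j (X z)| ≤ U) (hY : |Y z| ≤ U) (k j l : Fin M) :
    |pairExcess Y X f k j l z| ≤ 8 * U ^ 2 := by
  refine (abs_pairExcess_le hf hY k j l).trans ?_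
  have h0 : 0 ≤ U := (abs_nonneg _).trans hY
  have h1 : |f j (X z) - f k (X z)| ≤ 2 * U := by
    have := abs_sub (f j (X z)) (f k (X z))
    linarith [hf j, hf k]
  nlinarith [mul_le_mul_of_nonneg_left h1 h0]

variable {𝒵 𝒳 G Ω : Type*} [MeasurableSpace 𝒵] [MeasurableSpace 𝒳] [MeasurableSpace G]
  [MeasurableSpace Ω] {P : Measure 𝒵} {μ : Measure Ω} {M : ℕ}

lemma measurable_pairExcess {X : 𝒵 → 𝒳} (hX : Measurable X) {Yhat : G → 𝒵 → ℝ}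
    (hY : Measurable (Function.uncurry Yhat)) {f : Fin M → 𝒳 → ℝ} (hf : ∀ j, Measurable (f j))
    (k j l : Fin M) : Measurable (Function.uncurry fun g z => pairExcess (Yhat g) X f k j l z) := by
  have h : ∀ j, Measurable fun p : G × 𝒵 => f j (X p.2) := fun j =>
    (hf j).comp (hX.comp measurable_snd)
  have hY' : Measurable fun p : G × 𝒵 => Yhat p.1 p.2 := hY
  exact ((h j).sub (h k)).mul
    (((((h j).div_const 2).add ((h k).div_const 2)).add (h l)).sub (hY'.const_mul 2))

/-- The centred and penalised excess loss of a pair of candidates. -/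
noncomputable def pairDeviation (P : Measure 𝒵) (U : ℝ) (Y : 𝒵 → ℝ) (X : 𝒵 → 𝒳)
    (f : Fin M → 𝒳 → ℝ) (k j l : Fin M) (z : 𝒵) : ℝ :=
  1 / (56 * U ^ 2) * (∫ z', pairExcess Y X f k j l z' ∂P - pairExcess Y X f k j l z)
    - (1 / (56 * U ^ 2)) ^ 2 * (16 * U ^ 2 * ∫ z', (f j (X z') - f k (X z')) ^ 2 ∂P)

lemma measurable_pairDeviation [SFinite P] (U : ℝ) {X : 𝒵 → 𝒳} (hX : Measurable X)
    {Yhat : G → 𝒵 → ℝ} (hY : Measurable (Function.uncurry Yhat)) {f : Fin M → 𝒳 → ℝ}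
    (hf : ∀ j, Measurable (f j)) (k j l : Fin M) :
    Measurable (Function.uncurry fun g z => pairDeviation P U (Yhat g) X f k j l z) := by
  have h := measurable_pairExcess hX hY hf k j l
  have h1 : Measurable fun g => ∫ z', pairExcess (Yhat g) X f k j l z' ∂P :=
    (h.stronglyMeasurable.integral_prod_right (ν := P)).measurable
  exact (((h1.comp measurable_fst).sub h).const_mul _).sub_const _

/-- Bernstein with `λ = 1/(56 U²)`: the sup bound `8 U²` gives `λB = 1/7`, and keeping the factor
`f_j - f_k` gives the second-moment bound `16 U² S_j`. The variance is thus proportional to the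
squared distance that the curvature can absorb. -/
lemma lintegral_exp_pairDeviation_le_one [IsProbabilityMeasure P] {U : ℝ} (hU : 0 < U)
    {X : 𝒵 → 𝒳} (hX : Measurable X) {Y : 𝒵 → ℝ} (hY : Measurable Y) {f : Fin M → 𝒳 → ℝ}
    (hf : ∀ j, Measurable (f j)) (hfU : ∀ j, ∀ᵐ z ∂P, |f j (X z)| ≤ U)
    (hYU : ∀ᵐ z ∂P, |Y z| ≤ U) (k j l : Fin M) :
    ∫⁻ z, ENNReal.ofReal (Real.exp (pairDeviation P U Y X f k j l z)) ∂P ≤ 1 := by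
  have hfX : ∀ j, Measurable fun z => f j (X z) := fun j => (hf j).comp hX
  have hT : Measurable (pairExcess Y X f k j l) :=
    ((hfX j).sub (hfX k)).mul
      (((((hfX j).div_const 2).add ((hfX k).div_const 2)).add (hfX l)).sub (hY.const_mul 2))
  have hfU' := ae_all_iff.2 hfU
  refine lintegral_exp_deviation_le_one hT (B := 8 * U ^ 2) ?_ (by positivity) ?_ ?_
  · filter_upwards [hfU', hYU] with z h1 h2 using abs_pairExcess_le_sq h1 h2 k j l
  · rw [one_div, inv_mul_le_iff₀ (by positivity)]
    nlinarith [sq_nonneg U]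
  · rw [← integral_const_mul]
    refine integral_mono_ae ?_ ?_ ?_
    · refine Integrable.of_bound (hT.pow_const 2).aestronglyMeasurable ((8 * U ^ 2) ^ 2) ?_
      filter_upwards [hfU', hYU] with z h1 h2
      rw [Real.norm_eq_abs, abs_pow]
      exact pow_le_pow_left₀ (abs_nonneg _) (abs_pairExcess_le_sq h1 h2 k j l) 2
    · refine Integrable.of_bound
        ((((hfX j).sub (hfX k)).pow_const 2).const_mul _).aestronglyMeasurable
        (16 * U ^ 2 * (2 * U) ^ 2) ?_
      filter_upwards [hfU'] with z h1
      rw [Real.norm_eq_abs, abs_mul, abs_pow, abs_of_nonneg (by positivity : 0 ≤ 16 * U ^ 2)]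
      have : |f j (X z) - f k (X z)| ≤ 2 * U := by
        have := abs_sub (f j (X z)) (f k (X z))
        linarith [h1 j, h1 k]
      gcongr
    · filter_upwards [hfU', hYU] with z h1 h2
      have h3 := pow_le_pow_left₀ (abs_nonneg _) (abs_pairExcess_le h1 h2 k j l) 2
      rw [sq_abs, mul_pow, sq_abs] at h3
      linarith

lemma ae_map_of_ae_ae {ghat : Ω → G} (hg : Measurable ghat) {Yhat : G → 𝒵 → ℝ} [SFinite P]
    (hY : Measurable (Function.uncurry Yhat)) {U : ℝ}
    (h : ∀ᵐ ω ∂μ, ∀ᵐ z ∂P, |Yhat (ghat ω) z| ≤ U) :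
    ∀ᵐ g ∂(μ.map ghat), ∀ᵐ z ∂P, |Yhat g z| ≤ U := by
  have hm : MeasurableSet {p : G × 𝒵 | |Function.uncurry Yhat p| ≤ U}ᶜ :=
    (measurableSet_le (continuous_abs.measurable.comp hY) measurable_const).compl
  refine (ae_map_iff hg.aemeasurable ?_).2 h
  exact measurable_measure_prodMk_left (ν := P) hm (measurableSet_singleton 0)

/-- With probability at least `1 - δ`, all pairwise deviations are controlled simultaneously. -/
lemma measure_exists_pairDeviation_le [IsProbabilityMeasure P] [IsProbabilityMeasure μ]
    {X : 𝒵 → 𝒳} (hX : Measurable X) {Yhat : G → 𝒵 → ℝ}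
    (hY : Measurable (Function.uncurry Yhat)) {f : Fin M → 𝒳 → ℝ} (hf : ∀ j, Measurable (f j))
    {w : Fin M → ℝ} (hw : ∀ j, 0 < w j) (hw1 : ∑ j, w j = 1)
    {n : ℕ} {Z : Fin n → Ω → 𝒵} (hZ : ∀ i, Measurable (Z i))
    (hlaw : ∀ i, μ.map (Z i) = P) (hZind : iIndepFun Z μ)
    {ghat : Ω → G} (hg : Measurable ghat) (hind : IndepFun ghat (fun ω i => Z i ω) μ)
    {U : ℝ} (hU : 0 < U) (hfU : ∀ j, ∀ᵐ z ∂P, |f j (X z)| ≤ U)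
    (hYU : ∀ᵐ ω ∂μ, ∀ᵐ z ∂P, |Yhat (ghat ω) z| ≤ U) {δ : ℝ} (hδ : 0 < δ) (k : Fin M) :
    μ {ω | ∃ j l, Real.log (1 / (δ * (w j * w l)))
        ≤ ∑ i, pairDeviation P U (Yhat (ghat ω)) X f k j l (Z i ω)} ≤ ENNReal.ofReal δ := by
  have hset : {ω | ∃ j l, Real.log (1 / (δ * (w j * w l)))
        ≤ ∑ i, pairDeviation P U (Yhat (ghat ω)) X f k j l (Z i ω)}
      = ⋃ p : Fin M × Fin M, {ω | Real.log (1 / (δ * (w p.1 * w p.2)))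
        ≤ ∑ i, pairDeviation P U (Yhat (ghat ω)) X f k p.1 p.2 (Z i ω)} := by
    ext ω; simp
  -- The failure level `δ w_j w_l` of each pair sums to `δ` since the weights sum to one.
  have hpos : ∀ p : Fin M × Fin M, 0 < δ * (w p.1 * w p.2) := fun p =>
    mul_pos hδ (mul_pos (hw _) (hw _))
  rw [hset]
  calc _ ≤ ∑ p : Fin M × Fin M, μ {ω | Real.log (1 / (δ * (w p.1 * w p.2)))
        ≤ ∑ i, pairDeviation P U (Yhat (ghat ω)) X f k p.1 p.2 (Z i ω)} :=
        measure_iUnion_fintype_le _ _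
    _ ≤ ∑ p : Fin M × Fin M, ENNReal.ofReal (δ * (w p.1 * w p.2)) := by
        refine Finset.sum_le_sum fun p _ => ?_
        refine measure_log_le_sum_le hZ hlaw hZind hg hind
          (measurable_pairDeviation U hX hY hf k p.1 p.2) ?_ (hpos p)
        filter_upwards [ae_map_of_ae_ae hg hY hYU] with g hgU
        exact lintegral_exp_pairDeviation_le_one hU hX (hY.comp measurable_prodMk_left) hf hfU hgU
          k p.1 p.2
    _ = ENNReal.ofReal δ := by
        rw [← ENNReal.ofReal_sum_of_nonneg fun p _ => (hpos p).le, ← Finset.mul_sum,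
          Fintype.sum_prod_type, ← Finset.sum_mul_sum, hw1, mul_one, mul_one]

/-- Oracle inequality for the square loss on the event that all deviations are controlled. -/
lemma IsQAggregate.integral_excess_le [IsProbabilityMeasure P] {X : 𝒵 → 𝒳} (hX : Measurable X)
    {Y : 𝒵 → ℝ} (hY : Measurable Y) {f : Fin M → 𝒳 → ℝ} (hf : ∀ j, Measurable (f j))
    {w : Fin M → ℝ} (hw : ∀ j, 0 < w j) (hw1 : ∑ j, w j = 1) {n : ℕ} (hn : 0 < n)
    {s : Fin n → 𝒵} {U : ℝ} (hU : 0 < U) (hfU : ∀ j, ∀ᵐ z ∂P, |f j (X z)| ≤ U)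
    (hYU : ∀ᵐ z ∂P, |Y z| ≤ U) {β : ℝ} (hβ : 112 * U ^ 2 ≤ β) {θ : Fin M → ℝ}
    (hθ : IsQAggregate (1 / 2) β w Y X f s θ) {δ : ℝ} (hδ : 0 < δ) (k : Fin M)
    (hdev : ∀ j l, ∑ i, pairDeviation P U Y X f k j l (s i) ≤ Real.log (1 / (δ * (w j * w l)))) :
    ∫ z, (ensemble f θ (X z) - f k (X z)) * (ensemble f θ (X z) + f k (X z) - 2 * Y z) ∂P
      ≤ β / n * Real.log (1 / w k) + 56 * U ^ 2 * (Real.log (1 / δ) / n)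
        - 3 / 14 * ∫ z, (ensemble f θ (X z) - f k (X z)) ^ 2 ∂P := by
  have hθ1 : ∑ j, θ j = 1 := hθ.1.2
  have hθ0 : ∀ j, 0 ≤ θ j := hθ.1.1
  have hn' : (0 : ℝ) < n := by exact_mod_cast hn
  have hfX : ∀ j, Measurable fun z => f j (X z) := fun j => (hf j).comp hX
  have hfU' := ae_all_iff.2 hfU
  have hsqi : ∀ j, Integrable (fun z => (f j (X z) - f k (X z)) ^ 2) P := by
    intro j
    refine Integrable.of_bound (((hfX j).sub (hfX k)).pow_const 2).aestronglyMeasurable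
      ((2 * U) ^ 2) ?_
    filter_upwards [hfU'] with z h1
    rw [Real.norm_eq_abs, abs_pow]
    have : |f j (X z) - f k (X z)| ≤ 2 * U := by
      have := abs_sub (f j (X z)) (f k (X z))
      linarith [h1 j, h1 k]
    gcongr
  have hTi : ∀ j l, Integrable (pairExcess Y X f k j l) P := by
    intro j l
    have hT : Measurable (pairExcess Y X f k j l) :=
      ((hfX j).sub (hfX k)).mul
        (((((hfX j).div_const 2).add ((hfX k).div_const 2)).add (hfX l)).sub (hY.const_mul 2))
    refine Integrable.of_bound hT.aestronglyMeasurable (8 * U ^ 2) ?_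
    filter_upwards [hfU', hYU] with z h1 h2 using abs_pairExcess_le_sq h1 h2 k j l
  set S : Fin M → ℝ := fun j => ∫ z, (f j (X z) - f k (X z)) ^ 2 ∂P with hS
  set κ : Fin M → ℝ := fun j => Real.log (1 / w j) with hκ
  have hκ0 : ∀ j, 0 ≤ κ j := fun j => Real.log_nonneg (by
    rw [le_div_iff₀ (hw j), one_mul, ← hw1]
    exact Finset.single_le_sum (fun i _ => (hw i).le) (Finset.mem_univ j))
  have hpair : ∀ j l, ∫ z, pairExcess Y X f k j l z ∂P
      ≤ 1 / (n : ℝ) * ∑ i, pairExcess Y X f k j l (s i) + 2 / 7 * S j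
        + 56 * U ^ 2 / n * (Real.log (1 / δ) + κ j + κ l) := by
    intro j l
    have h := hdev j l
    have hlog : Real.log (1 / (δ * (w j * w l))) = Real.log (1 / δ) + κ j + κ l := by
      simp only [hκ, one_div, Real.log_inv]
      rw [Real.log_mul hδ.ne' (mul_pos (hw j) (hw l)).ne', Real.log_mul (hw j).ne' (hw l).ne']
      ring
    rw [hlog] at h
    simp only [pairDeviation, Finset.sum_sub_distrib, ← Finset.mul_sum, Finset.sum_const,
      Finset.card_univ, Fintype.card_fin, nsmul_eq_mul] at h
    -- Multiplying by `1/(nλ) = 56 U² / n` leaves the variance coefficient `16 U² λ = 2/7`.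
    have h2 := mul_le_mul_of_nonneg_left h (by positivity : 0 ≤ 56 * U ^ 2 / (n : ℝ))
    refine le_of_sub_nonneg ((sub_nonneg.2 h2).trans_eq ?_)
    simp only [hS]
    field_simp
    ring
  have hdbl : ∀ a : Fin M → ℝ, ∑ j, ∑ l, θ j * θ l * a j = ∑ j, θ j * a j := by
    intro a
    refine Finset.sum_congr rfl fun j _ => ?_
    rw [← Finset.sum_mul, ← Finset.mul_sum, hθ1, mul_one]
  have hdbl' : ∀ a : Fin M → ℝ, ∑ j, ∑ l, θ j * θ l * a l = ∑ j, θ j * a j := by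
    intro a
    rw [Finset.sum_comm, ← hdbl]
    exact Finset.sum_congr rfl fun j _ => Finset.sum_congr rfl fun l _ => by ring
  have hconst : ∀ a : ℝ, ∑ j, ∑ l, θ j * θ l * a = a := by
    intro a
    rw [hdbl fun _ => a, ← Finset.sum_mul, hθ1, one_mul]
  have hsum : ∑ j, ∑ l, θ j * θ l * ∫ z, pairExcess Y X f k j l z ∂P
      ≤ 1 / (n : ℝ) * ∑ i, ∑ j, ∑ l, θ j * θ l * pairExcess Y X f k j l (s i)
        + 2 / 7 * ∑ j, θ j * S j
        + 56 * U ^ 2 / n * (Real.log (1 / δ) + 2 * ∑ j, θ j * κ j) := by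
    have h1 : ∑ j, ∑ l, θ j * θ l * ∫ z, pairExcess Y X f k j l z ∂P
        ≤ ∑ j, ∑ l, θ j * θ l * (1 / (n : ℝ) * ∑ i, pairExcess Y X f k j l (s i) + 2 / 7 * S j
        + 56 * U ^ 2 / n * (Real.log (1 / δ) + κ j + κ l)) :=
      Finset.sum_le_sum fun j _ => Finset.sum_le_sum fun l _ =>
        mul_le_mul_of_nonneg_left (hpair j l) (mul_nonneg (hθ0 j) (hθ0 l))
    refine h1.trans_eq ?_
    have h3 : ∑ i, ∑ j, ∑ l, θ j * θ l * pairExcess Y X f k j l (s i)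
        = ∑ j, ∑ l, θ j * θ l * ∑ i, pairExcess Y X f k j l (s i) := by
      rw [Finset.sum_comm]
      refine Finset.sum_congr rfl fun j _ => ?_
      rw [Finset.sum_comm]
      simp only [Finset.mul_sum]
    have h2 : ∀ j l, θ j * θ l * (1 / (n : ℝ) * ∑ i, pairExcess Y X f k j l (s i) + 2 / 7 * S j
        + 56 * U ^ 2 / n * (Real.log (1 / δ) + κ j + κ l))
        = 1 / (n : ℝ) * (θ j * θ l * ∑ i, pairExcess Y X f k j l (s i))
          + 2 / 7 * (θ j * θ l * S j)
          + 56 * U ^ 2 / n * (θ j * θ l * Real.log (1 / δ) + θ j * θ l * κ j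
            + θ j * θ l * κ l) := by
      intro j l
      ring
    simp only [h2, h3, Finset.sum_add_distrib, ← Finset.mul_sum (a := 1 / (n : ℝ)),
      ← Finset.mul_sum (a := (2 / 7 : ℝ)), ← Finset.mul_sum (a := 56 * U ^ 2 / (n : ℝ))]
    rw [hdbl S, hconst, hdbl κ, hdbl' κ]
    ring
  have hopt := hθ.sum_pairExcess_le k
  have hint : ∫ z, (ensemble f θ (X z) - f k (X z)) * (ensemble f θ (X z) + f k (X z) - 2 * Y z) ∂P
      = ∑ j, ∑ l, θ j * θ l * ∫ z, pairExcess Y X f k j l z ∂P - 1 / 2 * ∑ j, θ j * S j := by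
    have h1 : ∀ z, (ensemble f θ (X z) - f k (X z)) * (ensemble f θ (X z) + f k (X z) - 2 * Y z)
        = ∑ j, ∑ l, θ j * θ l * pairExcess Y X f k j l z
          - 1 / 2 * ∑ j, θ j * (f j (X z) - f k (X z)) ^ 2 := by
      intro z
      rw [sum_pairExcess hθ1]
      ring
    simp only [h1]
    rw [integral_sub
      (integrable_finsetSum _ fun j _ => integrable_finsetSum _ fun l _ => (hTi j l).const_mul _)
      ((integrable_finsetSum _ fun j _ => (hsqi j).const_mul _).const_mul _),
      integral_const_mul, integral_finsetSum _ fun j _ => (hsqi j).const_mul _,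
      integral_finsetSum _ fun j _ => integrable_finsetSum _ fun l _ => (hTi j l).const_mul _]
    simp only [integral_const_mul]
    congr 1
    refine Finset.sum_congr rfl fun j _ => ?_
    rw [integral_finsetSum _ fun l _ => (hTi j l).const_mul _]
    simp only [integral_const_mul]
  have hjensen : ∫ z, (ensemble f θ (X z) - f k (X z)) ^ 2 ∂P ≤ ∑ j, θ j * S j := by
    simp only [hS, ← integral_const_mul]
    rw [← integral_finsetSum _ fun j _ => (hsqi j).const_mul _]
    refine integral_mono_of_nonneg (Filter.Eventually.of_forall fun z => sq_nonneg _)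
      (integrable_finsetSum _ fun j _ => (hsqi j).const_mul _)
      (Filter.Eventually.of_forall fun z => ?_)
    dsimp only
    rw [ensemble_sub_eq hθ1]
    have := (even_two.convexOn_pow (𝕜 := ℝ)).map_sum_le (t := Finset.univ) (w := θ)
      (p := fun j => f j (X z) - f k (X z)) (fun j _ => hθ0 j) hθ1 (fun _ _ => Set.mem_univ _)
    simpa only [smul_eq_mul] using this
  -- The two indices of a pair contribute `κ j` and `κ l`, whence the factor 2 and the requirement
  -- `112 U² ≤ β`.
  have hpen : 56 * U ^ 2 / n * (2 * ∑ j, θ j * κ j) ≤ β / n * ∑ j, θ j * κ j := by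
    have h1 : 0 ≤ ∑ j, θ j * κ j := Finset.sum_nonneg fun j _ => mul_nonneg (hθ0 j) (hκ0 j)
    calc 56 * U ^ 2 / n * (2 * ∑ j, θ j * κ j) = 112 * U ^ 2 / n * ∑ j, θ j * κ j := by ring
      _ ≤ β / n * ∑ j, θ j * κ j := by gcongr
  have h56 : 56 * U ^ 2 * (Real.log (1 / δ) / n) = 56 * U ^ 2 / n * Real.log (1 / δ) := by ring
  rw [hint, h56]
  -- The curvature coefficient is `1/2 - 2/7 = 3/14`.
  linarith

end Deviation

end QAgg
namespace QAgg

/-! ### Nuisance bias and its absorption -/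

section Bias

variable {G 𝒵 𝒳 : Type*} [MeasurableSpace 𝒵] [MeasurableSpace 𝒳] {P : Measure 𝒵}

lemma integral_mul_condX [IsProbabilityMeasure P] {X : 𝒵 → 𝒳} (hX : Measurable X) {d : 𝒳 → ℝ}
    (hd : Measurable d) {B : ℝ} (hB : ∀ᵐ z ∂P, |d (X z)| ≤ B) {W : 𝒵 → ℝ} (hW : Integrable W P) :
    ∫ z, d (X z) * condX P X W z ∂P = ∫ z, d (X z) * W z ∂P := by
  have hdm : StronglyMeasurable[MeasurableSpace.comap X inferInstance] fun z => d (X z) :=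
    (hd.comp (comap_measurable X)).stronglyMeasurable
  have h := condExp_stronglyMeasurable_mul_of_bound hX.comap_le hdm hW B hB
  have h1 := integral_condExp (μ := P) (f := (fun z => d (X z)) * W) hX.comap_le
  rw [integral_congr_ae h] at h1
  exact h1

/-- Since `a(X) - b(X)` is a function of `X`, the tower property replaces `τ₀` by `Ŷ(g₀)` under the
integral; exchanging `Ŷ(g₀)` for `Ŷ(g)` leaves the bias term. -/
lemma sqDist_sub_sqDist [IsProbabilityMeasure P] {X : 𝒵 → 𝒳} (hX : Measurable X)
    {Yhat : G → 𝒵 → ℝ} {g₀ g : G} (hY₀ : MemLp (Yhat g₀) 2 P) (hY : Integrable (Yhat g) P)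
    {a b : 𝒳 → ℝ} (ha : Measurable a) (hb : Measurable b) {U : ℝ}
    (haU : ∀ᵐ z ∂P, |a (X z)| ≤ U) (hbU : ∀ᵐ z ∂P, |b (X z)| ≤ U) :
    sqDist P X Yhat g₀ a - sqDist P X Yhat g₀ b
      = ∫ z, (a (X z) - b (X z)) * (a (X z) + b (X z) - 2 * Yhat g z) ∂P
        + 2 * ∫ z, (a (X z) - b (X z)) * bias P X Yhat g₀ g z ∂P := by
  have hτ : MemLp (condX P X (Yhat g₀)) 2 P := MemLp.condExp (by norm_num) hY₀
  have haX := ha.comp hX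
  have hbX := hb.comp hX
  have haL : MemLp (fun z => a (X z)) 2 P :=
    MemLp.of_bound haX.aestronglyMeasurable U haU
  have hbL : MemLp (fun z => b (X z)) 2 P :=
    MemLp.of_bound hbX.aestronglyMeasurable U hbU
  have hY₀i : Integrable (Yhat g₀) P := hY₀.integrable (by norm_num)
  have hdB : ∀ᵐ z ∂P, |a (X z) - b (X z)| ≤ 2 * U := by
    filter_upwards [haU, hbU] with z h1 h2
    have := abs_sub (a (X z)) (b (X z))
    linarith
  have hdm : Measurable fun x => a x - b x := ha.sub hb
  have hmul : ∀ {W : 𝒵 → ℝ}, Integrable W P → Integrable (fun z => (a (X z) - b (X z)) * W z) P :=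
    fun hW => hW.bdd_mul (c := 2 * U) (haX.sub hbX).aestronglyMeasurable hdB
  have hab : Integrable (fun z => a (X z) + b (X z)) P :=
    (haL.integrable (by norm_num)).add (hbL.integrable (by norm_num))
  have hτi : Integrable (condX P X (Yhat g₀)) P := integrable_condExp
  have hb1 := integral_mul_condX hX hdm hdB (hY.sub hY₀i)
  have hb2 := integral_mul_condX hX hdm hdB hY₀i
  rw [show condX P X (Yhat g - Yhat g₀) = bias P X Yhat g₀ g from rfl] at hb1
  have e1 : ∫ z, (a (X z) - b (X z)) * (Yhat g - Yhat g₀) z ∂P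
      = ∫ z, (a (X z) - b (X z)) * Yhat g z ∂P - ∫ z, (a (X z) - b (X z)) * Yhat g₀ z ∂P := by
    rw [← integral_sub (hmul hY) (hmul hY₀i)]
    exact integral_congr_ae (Filter.Eventually.of_forall fun z => by simp [mul_sub])
  have e2 : ∫ z, (a (X z) - b (X z)) * (a (X z) + b (X z) - 2 * Yhat g z) ∂P
      = ∫ z, (a (X z) - b (X z)) * (a (X z) + b (X z)) ∂P
        - 2 * ∫ z, (a (X z) - b (X z)) * Yhat g z ∂P := by
    rw [← integral_const_mul, ← integral_sub (hmul hab) ((hmul hY).const_mul 2)]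
    exact integral_congr_ae (Filter.Eventually.of_forall fun z => by ring)
  have e3 : sqDist P X Yhat g₀ a - sqDist P X Yhat g₀ b
      = ∫ z, (a (X z) - b (X z)) * (a (X z) + b (X z)) ∂P
        - 2 * ∫ z, (a (X z) - b (X z)) * condX P X (Yhat g₀) z ∂P := by
    have ia : Integrable (fun z => (a (X z) - condX P X (Yhat g₀) z) ^ 2) P :=
      (haL.sub hτ).integrable_sq
    have ib : Integrable (fun z => (b (X z) - condX P X (Yhat g₀) z) ^ 2) P :=
      (hbL.sub hτ).integrable_sq
    rw [sqDist, sqDist, ← integral_sub ia ib,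
      ← integral_const_mul, ← integral_sub (hmul hab) ((hmul hτi).const_mul 2)]
    exact integral_congr_ae (Filter.Eventually.of_forall fun z => by ring)
  rw [e3, e2, hb1, hb2, e1]
  ring

/-- Hölder with exponents `∞` and `1`: only the `L¹` norm of the bias enters. -/
lemma two_mul_integral_mul_le {d b : 𝒵 → ℝ} (hd : MemLp d 2 P) (hb : Integrable b P)
    {C : ℝ≥0} {γ : ℝ} (hγ : 0 < γ) (h : eLpNorm d ⊤ P ≤ C * eLpNorm d 2 P ^ γ) :
    2 * ∫ z, d z * b z ∂P
      ≤ 2 * (C : ℝ) * (∫ z, |b z| ∂P) * Real.sqrt (∫ z, d z ^ 2 ∂P) ^ γ := by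
  set r := Real.sqrt (∫ z, d z ^ 2 ∂P) with hr
  have hr0 : 0 ≤ r := Real.sqrt_nonneg _
  have h2 : eLpNorm d 2 P = ENNReal.ofReal r := by
    rw [hd.eLpNorm_eq_integral_rpow_norm (by norm_num) (by norm_num), hr, Real.sqrt_eq_rpow]
    simp
  have hC : (C : ℝ≥0∞) * eLpNorm d 2 P ^ γ = ENNReal.ofReal (C * r ^ γ) := by
    rw [h2, ENNReal.ofReal_rpow_of_nonneg hr0 hγ.le, ENNReal.ofReal_mul C.coe_nonneg,
      ENNReal.ofReal_coe_nnreal]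
  have hbound : ∀ᵐ z ∂P, |d z| ≤ C * r ^ γ := by
    filter_upwards [ae_le_eLpNormEssSup (f := d) (μ := P)] with z hz
    rw [eLpNorm_exponent_top, hC] at h
    have := hz.trans h
    rwa [Real.enorm_eq_ofReal_abs, ENNReal.ofReal_le_ofReal_iff (by positivity)] at this
  calc 2 * ∫ z, d z * b z ∂P ≤ 2 * ∫ z, C * r ^ γ * |b z| ∂P := by
        refine mul_le_mul_of_nonneg_left ?_ two_pos.le
        refine integral_mono_ae (hb.bdd_mul hd.aestronglyMeasurable hbound)
          (hb.abs.const_mul _) ?_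
        filter_upwards [hbound] with z hz
        exact (le_abs_self _).trans (by rw [abs_mul]; gcongr)
    _ = _ := by rw [integral_const_mul]; ring

/-- Young's inequality in the form that absorbs the bias into the curvature term. -/
lemma mul_rpow_le_sq_add {E r γ : ℝ} (hE : 0 ≤ E) (hr : 0 ≤ r) (hγ : 0 < γ) (hγ1 : γ ≤ 1) :
    E * r ^ γ ≤ 3 / 14 * r ^ 2 + 14 / 3 * E ^ (2 / (2 - γ)) := by
  have h2γ : 0 < 2 - γ := by linarith
  rcases le_or_gt E (3 / 14 * r ^ (2 - γ)) with h | h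
  · have h1 : E * r ^ γ ≤ 3 / 14 * r ^ 2 := by
      calc E * r ^ γ ≤ 3 / 14 * r ^ (2 - γ) * r ^ γ := by gcongr
        _ = 3 / 14 * r ^ (2 : ℝ) := by
            rw [mul_assoc, ← Real.rpow_add_of_nonneg hr h2γ.le hγ.le]; ring_nf
        _ = 3 / 14 * r ^ 2 := by norm_num
    have := Real.rpow_nonneg hE (2 / (2 - γ))
    linarith
  -- Here `r` is bounded by a power of `E`. Since `γ ≤ 1`, the exponent `γ/(2-γ)` is at most 1, so
  -- the constant stays below `14/3`.
  · have hEpos : 0 < E := lt_of_le_of_lt (by positivity) h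
    have h1 : r ^ (2 - γ) ≤ 14 / 3 * E := by linarith
    have h2 : r ^ γ ≤ (14 / 3 * E) ^ (γ / (2 - γ)) := by
      have h3 := Real.rpow_le_rpow (by positivity) h1 (by positivity : 0 ≤ γ / (2 - γ))
      rwa [← Real.rpow_mul hr, mul_div_cancel₀ _ h2γ.ne'] at h3
    have h4 : (14 / 3 : ℝ) ^ (γ / (2 - γ)) ≤ 14 / 3 := by
      calc (14 / 3 : ℝ) ^ (γ / (2 - γ)) ≤ (14 / 3 : ℝ) ^ (1 : ℝ) := by
            apply Real.rpow_le_rpow_of_exponent_le (by norm_num)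
            rw [div_le_one h2γ]; linarith
        _ = 14 / 3 := Real.rpow_one _
    calc E * r ^ γ ≤ E * (14 / 3 * E) ^ (γ / (2 - γ)) := by gcongr
      _ = (14 / 3 : ℝ) ^ (γ / (2 - γ)) * (E * E ^ (γ / (2 - γ))) := by
          rw [Real.mul_rpow (by norm_num) hE]; ring
      _ = (14 / 3 : ℝ) ^ (γ / (2 - γ)) * E ^ (2 / (2 - γ)) := by
          nth_rewrite 1 [← Real.rpow_one E]
          rw [← Real.rpow_add hEpos]
          congr 2
          field_simp
          ring
      _ ≤ 14 / 3 * E ^ (2 / (2 - γ)) := by gcongr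
      _ ≤ _ := by nlinarith [sq_nonneg r]

lemma measurable_ensemble {M : ℕ} {f : Fin M → 𝒳 → ℝ} (hf : ∀ j, Measurable (f j))
    (θ : Fin M → ℝ) : Measurable (ensemble f θ) :=
  Finset.measurable_sum _ fun j _ => (hf j).const_mul _

lemma abs_ensemble_le {𝒳 : Type*} {M : ℕ} {f : Fin M → 𝒳 → ℝ} {θ : Fin M → ℝ}
    (hθ : θ ∈ stdSimplex ℝ (Fin M)) {x : 𝒳} {U : ℝ} (h : ∀ j, |f j x| ≤ U) :
    |ensemble f θ x| ≤ U :=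
  calc |ensemble f θ x| ≤ ∑ j, |θ j * f j x| := Finset.abs_sum_le_sum_abs _ _
    _ ≤ ∑ j, θ j * U := Finset.sum_le_sum fun j _ => by
        rw [abs_mul, abs_of_nonneg (hθ.1 j)]
        exact mul_le_mul_of_nonneg_left (h j) (hθ.1 j)
    _ = U := by rw [← Finset.sum_mul, hθ.2, one_mul]

lemma nuisanceError_nonneg (X : 𝒵 → 𝒳) (Yhat : G → 𝒵 → ℝ) (g₀ : G) (C : ℝ≥0) (g : G) :
    0 ≤ nuisanceError P X Yhat g₀ C g :=
  mul_nonneg (by positivity) (integral_nonneg fun _ => abs_nonneg _)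

end Bias

end QAgg

/-! ### The oracle inequality -/

theorem corollary2 :
    -- an absolute constant
    ∃ K : ℝ, 0 < K ∧
      -- `P` is the law of a data point, `X` the covariates, `Yhat g` the label built from `g`
      ∀ (𝒵 𝒳 G Ω : Type*) [MeasurableSpace 𝒵] [MeasurableSpace 𝒳] [MeasurableSpace G]
        [MeasurableSpace Ω] (P : Measure 𝒵) [IsProbabilityMeasure P]
        (μ : Measure Ω) [IsProbabilityMeasure μ]
        (X : 𝒵 → 𝒳) (_ : Measurable X)
        (Yhat : G → 𝒵 → ℝ) (_ : Measurable (Function.uncurry Yhat))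
        (g₀ : G) (_ : MemLp (Yhat g₀) 2 P)
        -- candidate functions and prior weights
        (M : ℕ) (f : Fin M → 𝒳 → ℝ) (_ : ∀ j, Measurable (f j))
        (w : Fin M → ℝ) (_ : ∀ j, 0 < w j) (_ : ∑ j, w j = 1)
        -- i.i.d. sample, and a nuisance estimate trained on independent data
        (n : ℕ) (_ : 0 < n) (Z : Fin n → Ω → 𝒵) (_ : ∀ i, Measurable (Z i))
        (_ : ∀ i, μ.map (Z i) = P) (_ : iIndepFun Z μ)
        (ghat : Ω → G) (_ : Measurable ghat) (_ : IndepFun ghat (fun ω i => Z i ω) μ)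
        -- uniform bounds
        (U : ℝ) (_ : ∀ j, ∀ᵐ z ∂P, |f j (X z)| ≤ U)
        (_ : ∀ᵐ ω ∂μ, ∀ᵐ z ∂P, |Yhat (ghat ω) z| ≤ U)
        -- the sup-norm of differences of ensembles is controlled by their `L²`-norm
        (C : ℝ≥0) (γ : ℝ) (_ : 0 < γ) (_ : γ ≤ 1)
        (_ : ∀ θ ∈ stdSimplex ℝ (Fin M), ∀ θ' ∈ stdSimplex ℝ (Fin M),
          eLpNorm (fun z => QAgg.ensemble f θ (X z) - QAgg.ensemble f θ' (X z)) ⊤ P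
            ≤ C * eLpNorm (fun z => QAgg.ensemble f θ (X z) - QAgg.ensemble f θ' (X z)) 2 P ^ γ)
        -- the Q-aggregation ensemble with `ν = 1/2`
        (β : ℝ) (_ : max (112 * U ^ 2) (56 * U ^ 3) ≤ β)
        (θhat : Ω → Fin M → ℝ)
        (_ : ∀ᵐ ω ∂μ,
          QAgg.IsQAggregate (1 / 2) β w (Yhat (ghat ω)) X f (fun i => Z i ω) (θhat ω))
        (δ : ℝ) (_ : 0 < δ) (_ : δ < 1),
        -- the bound fails with (outer) probability at most `δ`
        μ {ω | ¬ QAgg.sqDist P X Yhat g₀ (QAgg.ensemble f (θhat ω)) ≤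
            (⨅ j, (QAgg.sqDist P X Yhat g₀ (f j) + β / n * Real.log (1 / w j)))
              + K * (max (U ^ 2) (U ^ 3) * Real.log (1 / δ) / n
                + QAgg.nuisanceError P X Yhat g₀ C (ghat ω) ^ (2 / (2 - γ)))}
          ≤ ENNReal.ofReal δ := by
  -- 56 is the coefficient of the deviation term and exceeds the `14/3` from Young's inequality.
  refine ⟨56, by norm_num, ?_⟩
  intro 𝒵 𝒳 G Ω _ _ _ _ P _ μ _ X hX Yhat hY g₀ hY₀ M f hf w hw hw1 n hn Z hZ hlaw hZind ghat hg
    hind U hfU hYU C γ hγ hγ1 hnorm β hβ θhat hθ δ hδ hδ1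
  have hβ1 : 112 * U ^ 2 ≤ β := (le_max_left _ _).trans hβ
  have hβ0 : 0 ≤ β := (by positivity : 0 ≤ 112 * U ^ 2).trans hβ1
  have hn' : (0 : ℝ) < n := by exact_mod_cast hn
  have hlogδ : 0 ≤ Real.log (1 / δ) :=
    Real.log_nonneg (by rw [le_div_iff₀ hδ]; linarith)
  have hfU' := ae_all_iff.2 hfU
  have hM : Nonempty (Fin M) := by
    by_contra hemp
    rw [not_nonempty_iff] at hemp
    simp at hw1
  -- The best candidate is deterministic, so no union bound over `k` is needed.
  obtain ⟨k, hk⟩ := exists_eq_ciInf_of_finite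
    (f := fun j => QAgg.sqDist P X Yhat g₀ (f j) + β / n * Real.log (1 / w j))
  have hU0 : 0 ≤ U := by
    obtain ⟨z, hz⟩ := (hfU k).exists
    exact (abs_nonneg _).trans hz
  have hE := fun ω => QAgg.nuisanceError_nonneg (P := P) X Yhat g₀ C (ghat ω)
  rw [← hk]
  -- For `U = 0` the scale `1/(56 U²)` degenerates, but all candidates vanish almost surely and the
  -- two distances agree.
  rcases hU0.eq_or_lt with rfl | hU
  · refine le_of_eq_of_le (measure_eq_zero_iff_ae_notMem.2 ?_) zero_le
    filter_upwards [hθ] with ω hω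
    simp only [not_not]
    have h0 : QAgg.sqDist P X Yhat g₀ (QAgg.ensemble f (θhat ω)) 
        = QAgg.sqDist P X Yhat g₀ (f k) := by
      refine integral_congr_ae ?_
      filter_upwards [hfU'] with z hz
      have h1 := abs_nonpos_iff.1 (QAgg.abs_ensemble_le hω.1 hz)
      have h2 := abs_nonpos_iff.1 (hz k)
      simp only [h1, h2]
    have h1 : 0 ≤ Real.log (1 / w k) := Real.log_nonneg (by
      rw [le_div_iff₀ (hw k), one_mul, ← hw1]
      exact Finset.single_le_sum (fun i _ => (hw i).le) (Finset.mem_univ k))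
    have h2 := Real.rpow_nonneg (hE ω) (2 / (2 - γ))
    have h3 : 0 ≤ β / n * Real.log (1 / w k) := by positivity
    have h4 : max ((0 : ℝ) ^ 2) (0 ^ 3) = 0 := by norm_num
    rw [h0, h4, zero_mul, zero_div]
    linarith
  -- The deviation event involves only `ghat` and the sample, so no measurability of `θhat` is
  -- needed.
  · refine (measure_mono_ae ?_).trans (QAgg.measure_exists_pairDeviation_le hX hY hf hw hw1 hZ hlaw
      hZind hg hind hU hfU hYU hδ k)
    filter_upwards [hθ, hYU] with ω hω hYω hbad
    by_contra hgood
    refine hbad ?_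
    have hdev : ∀ j l, ∑ i, QAgg.pairDeviation P U (Yhat (ghat ω)) X f k j l (Z i ω)
        ≤ Real.log (1 / (δ * (w j * w l))) := by
      intro j l
      by_contra! h
      exact hgood ⟨j, l, h.le⟩
    have hYm : Measurable (Yhat (ghat ω)) := hY.comp measurable_prodMk_left
    have hYi : Integrable (Yhat (ghat ω)) P :=
      Integrable.of_bound hYm.aestronglyMeasurable U hYω
    have hens : ∀ᵐ z ∂P, |QAgg.ensemble f (θhat ω) (X z)| ≤ U :=
      hfU'.mono fun z hz => QAgg.abs_ensemble_le hω.1 hz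
    have hem := QAgg.measurable_ensemble hf (θhat ω)
    have horacle := hω.integral_excess_le hX hYm hf hw hw1 hn hU hfU hYω hβ1 hδ k hdev
    have hsq := QAgg.sqDist_sub_sqDist (g := ghat ω) hX hY₀ hYi hem (hf k) hens (hfU k)
    have hdL : MemLp (fun z => QAgg.ensemble f (θhat ω) (X z) - f k (X z)) 2 P :=
      (MemLp.of_bound (hem.comp hX).aestronglyMeasurable U hens).sub
        (MemLp.of_bound ((hf k).comp hX).aestronglyMeasurable U (hfU k))
    have hCk := hnorm _ hω.1 _ (single_mem_stdSimplex ℝ k)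
    simp only [QAgg.ensemble_single] at hCk
    have hbias := QAgg.two_mul_integral_mul_le hdL
      (b := QAgg.bias P X Yhat g₀ (ghat ω)) integrable_condExp hγ hCk
    have hyoung := QAgg.mul_rpow_le_sq_add (hE ω)
      (Real.sqrt_nonneg (∫ z, (QAgg.ensemble f (θhat ω) (X z) - f k (X z)) ^ 2 ∂P)) hγ hγ1
    rw [Real.sq_sqrt (integral_nonneg fun _ => sq_nonneg _)] at hyoung
    rw [← QAgg.nuisanceError] at hbias
    have h2 := Real.rpow_nonneg (hE ω) (2 / (2 - γ))
    have h3 : U ^ 2 * (Real.log (1 / δ) / n)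
        ≤ max (U ^ 2) (U ^ 3) * Real.log (1 / δ) / n := by
      rw [mul_div_assoc]
      exact mul_le_mul_of_nonneg_right (le_max_left _ _) (by positivity)
    -- The `3/14 ‖f_θ - f_k‖²` from Young's inequality cancels the curvature term of `horacle`.
    linarith
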